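/- Let $G$ be a finite group and let $T$ be a $G$-Tambara functor. A \emph{Tambara ideal} $I$ of $T$ is a collection of ideals $I(G/H)\subseteq T(G/H)$, one for each subgroup $H\leq G$, that is closed under the restrictions $\mathrm{res}^K_H$, transfers $\mathrm{tr}^K_H$, norms $\mathrm{nm}^K_H$ ($H\le K\le G$) and conjugations $T(G/H)\to T(G/gHg^{-1})$ ($g \in G$) of $T$. The product $IJ$ of two Tambara ideals is the smallest Tambara ideal that contains $I(G/H)\cdot J(G/H)$ for every $H\leq G$; powers are defined by $I^0=T$ and $I^{n+1}=I^n\cdot I$, and $0$ denotes the Tambara ideal that is zero at every level. For $y\in T(G/H)$, let $\langle y\rangle$ be the smallest Tambara ideal with $y\in\langle y\rangle(G/H)$. \textbf{Theorem.} Let $T$ be a $G$-Tambara functor, let $H\leq G$, and let $y\in T(G/H)$. The following are equivalent: (1) $y$ is nilpotent in the commutative ring $T(G/H)$, i.e. $y^n=0$ for some natural number $n$; (2) $\langle y\rangle^n=0$ for some natural number $n$. -/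

import Mathlib

universe u v

/-- A finite `G`-set. -/
structure FinGSet (G : Type u) [Group G] where
  carrier : Type u
  [action : MulAction G carrier]
  [finite : Finite carrier]

namespace FinGSet

variable {G : Type u} [Group G]

instance : CoeSort (FinGSet G) (Type u) := ⟨FinGSet.carrier⟩

instance (X : FinGSet G) : MulAction G X := X.action

instance (X : FinGSet G) : Finite X := X.finite

/-- Morphisms of finite `G`-sets: equivariant maps. -/
abbrev Hom (X Y : FinGSet G) : Type u := X →[G] Y

/-- The disjoint union `X ⨿ Y`. -/
def sum (X Y : FinGSet G) : FinGSet G where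
  carrier := X ⊕ Y

/-- The inclusion `X → X ⨿ Y`. -/
def inl (X Y : FinGSet G) : Hom X (sum X Y) where
  toFun := Sum.inl
  map_smul' _ _ := rfl

/-- The inclusion `Y → X ⨿ Y`. -/
def inr (X Y : FinGSet G) : Hom Y (sum X Y) where
  toFun := Sum.inr
  map_smul' _ _ := rfl

/-- The fold map `∇ : X ⨿ X → X`. -/
def fold (X : FinGSet G) : Hom (sum X X) X where
  toFun := Sum.elim id id
  map_smul' g x := by cases x <;> rfl

/-- The empty `G`-set. -/
def empty (G : Type u) [Group G] : FinGSet G where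
  carrier := PEmpty
  action :=
    { smul := fun _ x => x
      one_smul := fun _ => rfl
      mul_smul := fun _ _ _ => rfl }

/-- The unique map `∅ → X`. -/
def fromEmpty (X : FinGSet G) : Hom (empty G) X where
  toFun x := PEmpty.elim x
  map_smul' _ x := PEmpty.elim x

/-- The square with legs `f' : P → X'`, `g' : P → X` over `f : X → Y`, `g : X' → Y`
is a pullback square of finite `G`-sets. -/
structure IsPullback {P X X' Y : FinGSet G} (f' : Hom P X') (g' : Hom P X)
    (f : Hom X Y) (g : Hom X' Y) : Prop where
  comm : ∀ p : P, f (g' p) = g (f' p)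
  existsUnique : ∀ (x : X) (x' : X'), f x = g x' → ∃! p : P, g' p = x ∧ f' p = x'

/-- `X ←ε- P -f'→ B -p→ Z` is an exponential diagram for `X -g→ Y -f→ Z`.

That is: `p : B → Z` is the dependent product `Π_f g`, whose fibre over `z` is the set of
sections `s` of `g` over the fibre `f⁻¹(z)`; the object `P`, with its maps `q` to `Y` and `f'` to
`B`, is the pullback of `f` and `p`; and `ε : P → X` is the counit, i.e. the evaluation
`(y, s) ↦ s y`. -/
structure IsExponential {X Y Z B P : FinGSet G} (g : Hom X Y) (f : Hom Y Z) (p : Hom B Z)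
    (f' : Hom P B) (q : Hom P Y) (ε : Hom P X) : Prop where
  isPullback : IsPullback f' q f p
  comm : ∀ e : P, g (ε e) = q e
  existsUnique : ∀ (z : Z) (s : {y : Y // f y = z} → X), (∀ y, g (s y) = y.1) →
    ∃! b : B, p b = z ∧ ∀ (e : P) (y : {y : Y // f y = z}), f' e = b → q e = y.1 → ε e = s y

/-- The orbit `G/H`. -/
def orbit [Finite G] (H : Subgroup G) : FinGSet G where
  carrier := G ⧸ H

/-- The canonical quotient `G/H → G/K`, `xH ↦ xK`, for `H ≤ K`. -/
def quot [Finite G] {H K : Subgroup G} (h : H ≤ K) : Hom (orbit H) (orbit K) where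
  toFun := Subgroup.quotientMapOfLE h
  map_smul' g x := by
    induction x using QuotientGroup.induction_on
    rfl

/-- The conjugate subgroup `gHg⁻¹`. -/
def conjSubgroup (g : G) (H : Subgroup G) : Subgroup G := H.map (MulAut.conj g).toMonoidHom

/-- The canonical isomorphism `G/H → G/gHg⁻¹`, `xH ↦ xg⁻¹(gHg⁻¹)`. -/
def conjMap [Finite G] (g : G) (H : Subgroup G) :
    Hom (orbit H) (orbit (conjSubgroup g H)) where
  toFun := Quotient.lift (fun x : G => ((x * g⁻¹ : G) : G ⧸ conjSubgroup g H)) (by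
    intro a b hab
    refine QuotientGroup.eq.2 ⟨a⁻¹ * b, QuotientGroup.leftRel_apply.1 hab, ?_⟩
    simp [mul_assoc])
  map_smul' k x := by
    induction x using QuotientGroup.induction_on with
    | H x => exact congrArg (QuotientGroup.mk (s := conjSubgroup g H)) (mul_assoc k x g⁻¹)

end FinGSet

open FinGSet in
/-- A `G`-semi-Tambara functor: a product-preserving functor from the category of bispans of
finite `G`-sets to sets, given by its values on objects and on the generating morphisms `T_f`,
`N_f`, `R_f`, subject to the rules that govern the composition of bispans. -/
structure SemiTambaraFunctor (G : Type u) [Group G] where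
  obj : FinGSet G → Type v
  /-- transfer along `f` -/
  tr : ∀ {X Y : FinGSet G}, Hom X Y → obj X → obj Y
  /-- norm along `f` -/
  nm : ∀ {X Y : FinGSet G}, Hom X Y → obj X → obj Y
  /-- restriction along `f` -/
  res : ∀ {X Y : FinGSet G}, Hom X Y → obj Y → obj X
  tr_id : ∀ {X : FinGSet G} (a : obj X), tr (MulActionHom.id G) a = a
  nm_id : ∀ {X : FinGSet G} (a : obj X), nm (MulActionHom.id G) a = a
  res_id : ∀ {X : FinGSet G} (a : obj X), res (MulActionHom.id G) a = a
  tr_comp : ∀ {X Y Z : FinGSet G} (f : Hom Y Z) (g : Hom X Y) (a : obj X),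
    tr (f.comp g) a = tr f (tr g a)
  nm_comp : ∀ {X Y Z : FinGSet G} (f : Hom Y Z) (g : Hom X Y) (a : obj X),
    nm (f.comp g) a = nm f (nm g a)
  res_comp : ∀ {X Y Z : FinGSet G} (f : Hom Y Z) (g : Hom X Y) (a : obj Z),
    res (f.comp g) a = res g (res f a)
  res_tr : ∀ {P X X' Y : FinGSet G} (f' : Hom P X') (g' : Hom P X) (f : Hom X Y) (g : Hom X' Y),
    IsPullback f' g' f g → ∀ a : obj X', res f (tr g a) = tr g' (res f' a)
  res_nm : ∀ {P X X' Y : FinGSet G} (f' : Hom P X') (g' : Hom P X) (f : Hom X Y) (g : Hom X' Y),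
    IsPullback f' g' f g → ∀ a : obj X', res f (nm g a) = nm g' (res f' a)
  nm_tr : ∀ {X Y Z B P : FinGSet G} (g : Hom X Y) (f : Hom Y Z) (p : Hom B Z) (f' : Hom P B)
    (q : Hom P Y) (ε : Hom P X), IsExponential g f p f' q ε →
    ∀ a : obj X, nm f (tr g a) = tr p (nm f' (res ε a))
  /-- preservation of the terminal object -/
  obj_empty : Nonempty (Unique (obj (empty G)))
  /-- preservation of binary products -/
  obj_sum : ∀ X Y : FinGSet G, Function.Bijective
    fun c : obj (sum X Y) => (res (inl X Y) c, res (inr X Y) c)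

open FinGSet in
/-- A `G`-Tambara functor: a `G`-semi-Tambara functor `S` such that each `S(X)`, with the zero,
one, addition and multiplication induced by `T_!`, `N_!`, `T_∇`, `N_∇`, is a commutative ring.
(The last four fields determine the ring structure, so it is not additional data.) -/
structure TambaraFunctor (G : Type u) [Group G] extends SemiTambaraFunctor.{u, v} G where
  commRing : ∀ X : FinGSet G, CommRing (obj X)
  tr_fromEmpty : ∀ (X : FinGSet G) (c : obj (empty G)), tr (fromEmpty X) c = 0
  nm_fromEmpty : ∀ (X : FinGSet G) (c : obj (empty G)), nm (fromEmpty X) c = 1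
  tr_fold : ∀ (X : FinGSet G) (c : obj (sum X X)),
    tr (fold X) c = res (inl X X) c + res (inr X X) c
  nm_fold : ∀ (X : FinGSet G) (c : obj (sum X X)),
    nm (fold X) c = res (inl X X) c * res (inr X X) c

namespace TambaraFunctor

open FinGSet

variable {G : Type u} [Group G] (T : TambaraFunctor.{u, v} G)

instance (X : FinGSet G) : CommRing (T.obj X) := T.commRing X

lemma nonempty_obj_empty : Nonempty (T.obj (empty G)) :=
  T.obj_empty.elim fun h => ⟨h.default⟩

lemma tr_zero {X Y : FinGSet G} (f : Hom X Y) : T.tr f 0 = 0 := by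
  obtain ⟨c⟩ := T.nonempty_obj_empty
  have hc : f.comp (fromEmpty X) = fromEmpty Y := by
    ext x
    exact PEmpty.elim x
  rw [← T.tr_fromEmpty X c, ← T.tr_comp, hc, T.tr_fromEmpty]

lemma res_zero {X Y : FinGSet G} (f : Hom X Y) : T.res f 0 = 0 := by
  obtain ⟨c⟩ := T.nonempty_obj_empty
  rw [← T.tr_fromEmpty Y c,
    T.res_tr (MulActionHom.id G) (fromEmpty X) f (fromEmpty Y)
      ⟨fun x => PEmpty.elim x, fun _ x => PEmpty.elim x⟩, T.tr_fromEmpty]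

lemma nm_zero {X Y : FinGSet G} (f : Hom X Y) (hf : Function.Surjective f) : T.nm f 0 = 0 := by
  obtain ⟨c⟩ := T.nonempty_obj_empty
  rw [← T.tr_fromEmpty X c,
    T.nm_tr (fromEmpty X) f (fromEmpty Y) (MulActionHom.id G) (fromEmpty X) (MulActionHom.id G)
      ⟨⟨fun x => PEmpty.elim x, fun _ x => PEmpty.elim x⟩, fun x => PEmpty.elim x, ?_⟩,
    T.tr_fromEmpty]
  intro z s _
  obtain ⟨x, hx⟩ := hf z
  exact PEmpty.elim (s ⟨x, hx⟩)

variable [Finite G]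

/-- The restriction `res^K_H`. -/
def resLE {H K : Subgroup G} (h : H ≤ K) : T.obj (orbit K) → T.obj (orbit H) := T.res (quot h)

/-- The transfer `tr^K_H`. -/
def trLE {H K : Subgroup G} (h : H ≤ K) : T.obj (orbit H) → T.obj (orbit K) := T.tr (quot h)

/-- The norm `nm^K_H`. -/
def nmLE {H K : Subgroup G} (h : H ≤ K) : T.obj (orbit H) → T.obj (orbit K) := T.nm (quot h)

/-- The conjugation `c_{g,H} : T(G/H) → T(G/gHg⁻¹)`. -/
def conj (g : G) (H : Subgroup G) : T.obj (orbit H) → T.obj (orbit (conjSubgroup g H)) :=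
  T.tr (conjMap g H)

end TambaraFunctor

/-- A Tambara ideal of `T`: ideals of all `T(G/H)`, closed under restriction, transfer, norm and
conjugation. -/
structure TambaraIdeal {G : Type u} [Group G] [Finite G] (T : TambaraFunctor.{u, v} G) where
  level : ∀ H : Subgroup G, Ideal (T.obj (FinGSet.orbit H))
  res_mem : ∀ {H K : Subgroup G} (h : H ≤ K), ∀ a ∈ level K, T.resLE h a ∈ level H
  tr_mem : ∀ {H K : Subgroup G} (h : H ≤ K), ∀ a ∈ level H, T.trLE h a ∈ level K
  nm_mem : ∀ {H K : Subgroup G} (h : H ≤ K), ∀ a ∈ level H, T.nmLE h a ∈ level K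
  conj_mem : ∀ (g : G) (H : Subgroup G), ∀ a ∈ level H,
    T.conj g H a ∈ level (FinGSet.conjSubgroup g H)

namespace TambaraIdeal

open FinGSet

variable {G : Type u} [Group G] [Finite G] {T : TambaraFunctor.{u, v} G}

/-- The zero ideal, which is zero at every level. -/
instance : Zero (TambaraIdeal T) where
  zero :=
    { level := fun _ => ⊥
      res_mem := fun h a ha => by
        rw [Ideal.mem_bot] at ha ⊢
        rw [ha]
        exact T.res_zero _
      tr_mem := fun h a ha => by
        rw [Ideal.mem_bot] at ha ⊢
        rw [ha]
        exact T.tr_zero _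
      nm_mem := fun {H K} h a ha => by
        rw [Ideal.mem_bot] at ha ⊢
        rw [ha]
        refine T.nm_zero _ fun x => ?_
        induction x using QuotientGroup.induction_on with
        | H x => exact ⟨(x : G ⧸ H), rfl⟩
      conj_mem := fun g H a ha => by
        rw [Ideal.mem_bot] at ha ⊢
        rw [ha]
        exact T.tr_zero _ }

/-- The unit ideal `T`. -/
instance : Top (TambaraIdeal T) where
  top :=
    { level := fun _ => ⊤
      res_mem := fun _ _ _ => Submodule.mem_top
      tr_mem := fun _ _ _ => Submodule.mem_top
      nm_mem := fun _ _ _ => Submodule.mem_top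
      conj_mem := fun _ _ _ _ => Submodule.mem_top }

/-- The intersection of a set of Tambara ideals. -/
instance : InfSet (TambaraIdeal T) where
  sInf S :=
    { level := fun H => ⨅ I ∈ S, I.level H
      res_mem := fun h a ha => by
        simp only [Submodule.mem_iInf] at ha ⊢
        exact fun I hI => I.res_mem h a (ha I hI)
      tr_mem := fun h a ha => by
        simp only [Submodule.mem_iInf] at ha ⊢
        exact fun I hI => I.tr_mem h a (ha I hI)
      nm_mem := fun h a ha => by
        simp only [Submodule.mem_iInf] at ha ⊢
        exact fun I hI => I.nm_mem h a (ha I hI)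
      conj_mem := fun g H a ha => by
        simp only [Submodule.mem_iInf] at ha ⊢
        exact fun I hI => I.conj_mem g H a (ha I hI) }

/-- The product `IJ`: the intersection of all Tambara ideals `K` with
`I(G/H) · J(G/H) ⊆ K(G/H)` for all `H`. -/
instance : Mul (TambaraIdeal T) where
  mul I J := sInf {K | ∀ H : Subgroup G, I.level H * J.level H ≤ K.level H}

/-- Powers of a Tambara ideal: `I ^ 0 = T` and `I ^ (n + 1) = I ^ n * I`. -/
instance : Pow (TambaraIdeal T) ℕ where
  pow I n := n.rec ⊤ fun _ J => J * I

/-- The Tambara ideal `⟨y⟩` generated by `y ∈ T(G/H)`. -/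
def generatedBy {H : Subgroup G} (y : T.obj (orbit H)) : TambaraIdeal T :=
  sInf {I | y ∈ I.level H}

end TambaraIdeal

/-! If `⟨y⟩ ^ n = 0`, then `y ^ n`, which lies in `⟨y⟩ ^ n` at level `H`, vanishes. The converse
rests on a normal form: every element of `⟨y⟩ ^ n` is a transfer `T_f (c * N_g R_w y)` in which each
fibre of `g` has at least `n` points. For fixed `n` such elements form a Tambara ideal: base change
handles restrictions, the distributive law handles norms. Products add the fibre bounds
(`IsTransferNorm.mul`), so induction gives `generatedBy_pow_le`.

If `y ^ k = 0` and the fibres of `g : D → C` are large enough, then `N_g R_w y = 0`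
(`nm_res_eq_zero`). It suffices to treat transitive `C`. Orbits have at most `|G|` points, so `D`
has many orbits, and by pigeonhole `k` of them are copies of one `G/S` with the same maps to `C` and
`Z`. They contribute the factor `(N R y) ^ k = N R (y ^ k) = N 0`, which is zero because `G/S → C`
is surjective. -/

/-! ### Coproducts, fibre products and dependent products of finite `G`-sets. -/

namespace FinGSet

open scoped Pointwise

variable {G : Type u} [Group G]

/-- The map `X ⨿ Y → Z` with components `f` and `g`. -/
def copair {X Y Z : FinGSet G} (f : Hom X Z) (g : Hom Y Z) : Hom (sum X Y) Z where
  toFun := Sum.elim f g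
  map_smul' a x := by
    cases x with
    | inl x => exact map_smul f a x
    | inr x => exact map_smul g a x

/-- The map `f ⨿ g : X ⨿ Y → X' ⨿ Y'`. -/
def sumMap {X Y X' Y' : FinGSet G} (f : Hom X X') (g : Hom Y Y') :
    Hom (sum X Y) (sum X' Y') :=
  copair ((inl X' Y').comp f) ((inr X' Y').comp g)

lemma copair_comp_inl {X Y Z : FinGSet G} (f : Hom X Z) (g : Hom Y Z) :
    (copair f g).comp (inl X Y) = f := rfl

lemma copair_comp_inr {X Y Z : FinGSet G} (f : Hom X Z) (g : Hom Y Z) :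
    (copair f g).comp (inr X Y) = g := rfl

lemma fold_comp_sumMap {X Y Z : FinGSet G} (f : Hom X Z) (g : Hom Y Z) :
    (fold Z).comp (sumMap f g) = copair f g := by
  ext x
  cases x <;> rfl

lemma isPullback_inl {X Y X' Y' : FinGSet G} (f : Hom X X') (g : Hom Y Y') :
    IsPullback (inl X Y) f (inl X' Y') (sumMap f g) where
  comm _ := rfl
  existsUnique x z h := by
    cases z with
    | inl z => exact ⟨z, ⟨(Sum.inl_injective h).symm, rfl⟩, fun p hp => Sum.inl_injective hp.2⟩
    | inr z => exact (Sum.inl_ne_inr h).elim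

lemma isPullback_inr {X Y X' Y' : FinGSet G} (f : Hom X X') (g : Hom Y Y') :
    IsPullback (inr X Y) g (inr X' Y') (sumMap f g) where
  comm _ := rfl
  existsUnique x z h := by
    cases z with
    | inr z => exact ⟨z, ⟨(Sum.inr_injective h).symm, rfl⟩, fun p hp => Sum.inr_injective hp.2⟩
    | inl z => exact (Sum.inr_ne_inl h).elim

lemma isPullback_fold {X Y : FinGSet G} (f : Hom X Y) :
    IsPullback (sumMap f f) (fold X) f (fold Y) where
  comm p := by cases p <;> rfl
  existsUnique x z h := by
    cases z with
    | inl z =>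
      refine ⟨Sum.inl x, ⟨rfl, congrArg Sum.inl h⟩, fun p hp => ?_⟩
      cases p with
      | inl p => exact congrArg Sum.inl hp.1
      | inr p => exact (Sum.inr_ne_inl hp.2).elim
    | inr z =>
      refine ⟨Sum.inr x, ⟨rfl, congrArg Sum.inr h⟩, fun p hp => ?_⟩
      cases p with
      | inr p => exact congrArg Sum.inr hp.1
      | inl p => exact (Sum.inl_ne_inr hp.2).elim

/-- A `G`-invariant subset, as a finite `G`-set. -/
def sub (X : FinGSet G) (S : SubMulAction G X) : FinGSet G where
  carrier := S

/-- The inclusion of a `G`-invariant subset. -/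
def incl (X : FinGSet G) (S : SubMulAction G X) : Hom (sub X S) X where
  toFun := Subtype.val
  map_smul' _ _ := rfl

/-- The complement of a `G`-invariant subset. -/
def complSub (X : FinGSet G) (S : SubMulAction G X) : SubMulAction G X where
  carrier := {x | x ∉ S}
  smul_mem' g x hx h := hx (by simpa using S.smul_mem g⁻¹ h)

/-- The product of finite `G`-sets. -/
def prod (X Y : FinGSet G) : FinGSet G where
  carrier := X × Y

/-- The pairs with the same image, as a `G`-invariant subset of the product. -/
def pullbackSub {X X' Y : FinGSet G} (f : Hom X Y) (g : Hom X' Y) :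
    SubMulAction G (prod X X') where
  carrier := {p | f p.1 = g p.2}
  smul_mem' a p hp := by
    change f (a • p.1) = g (a • p.2)
    rw [map_smul, map_smul]
    exact congrArg (a • ·) hp

/-- The fibre product. -/
def pullback {X X' Y : FinGSet G} (f : Hom X Y) (g : Hom X' Y) : FinGSet G :=
  sub _ (pullbackSub f g)

/-- The first projection of the fibre product. -/
def pullbackFst {X X' Y : FinGSet G} (f : Hom X Y) (g : Hom X' Y) : Hom (pullback f g) X where
  toFun p := p.1.1
  map_smul' _ _ := rfl

/-- The second projection of the fibre product. -/
def pullbackSnd {X X' Y : FinGSet G} (f : Hom X Y) (g : Hom X' Y) : Hom (pullback f g) X' where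
  toFun p := p.1.2
  map_smul' _ _ := rfl

lemma isPullback_pullback {X X' Y : FinGSet G} (f : Hom X Y) (g : Hom X' Y) :
    IsPullback (pullbackSnd f g) (pullbackFst f g) f g where
  comm p := p.2
  existsUnique x x' h :=
    ⟨⟨(x, x'), h⟩, ⟨rfl, rfl⟩, fun _ hp => Subtype.ext (Prod.ext hp.1 hp.2)⟩

/-- The pairs of a point `z` and a section over `f⁻¹(z)`, given by its image in `X`. -/
def sectionSub {X Y Z : FinGSet G} (g : Hom X Y) (f : Hom Y Z) :
    SubMulAction G (Z × Set X) where
  -- Encoding a section by its image makes the conjugation action on sections the pointwise action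
  -- on subsets, and finiteness is inherited from `Z × Set X`.
  carrier := {b | (∀ x ∈ b.2, f (g x) = b.1) ∧ ∀ y, f y = b.1 → ∃! x, x ∈ b.2 ∧ g x = y}
  smul_mem' a b hb := by
    refine ⟨?_, fun y hy => ?_⟩
    · rintro _ ⟨x, hx, rfl⟩
      change f (g (a • x)) = a • b.1
      rw [map_smul, map_smul, hb.1 x hx]
    · obtain ⟨x, hx, hu⟩ := hb.2 (a⁻¹ • y) (by
        rw [map_smul, hy]
        exact inv_smul_smul a b.1)
      refine ⟨a • x, ⟨⟨x, hx.1, rfl⟩, by rw [map_smul, hx.2, smul_inv_smul]⟩, ?_⟩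
      rintro _ ⟨⟨x', hx', rfl⟩, h⟩
      refine congrArg (a • ·) (hu x' ⟨hx', ?_⟩)
      rw [← h]
      change g x' = a⁻¹ • g (a • x')
      rw [map_smul, inv_smul_smul]

/-- The dependent product `Π_f g`. -/
def depProd {X Y Z : FinGSet G} (g : Hom X Y) (f : Hom Y Z) : FinGSet G where
  carrier := sectionSub g f

/-- The structure map `Π_f g → Z`. -/
def depProdMap {X Y Z : FinGSet G} (g : Hom X Y) (f : Hom Y Z) : Hom (depProd g f) Z where
  toFun b := b.1.1
  map_smul' _ _ := rfl

/-- The pairs of an element of `X` and a section through it. -/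
def evalSub {X Y Z : FinGSet G} (g : Hom X Y) (f : Hom Y Z) :
    SubMulAction G (prod X (depProd g f)) where
  carrier := {p | p.1 ∈ p.2.1.2}
  smul_mem' _ _ hp := Set.smul_mem_smul_set hp

/-- The pullback of `Π_f g` along `f`. -/
def evalObj {X Y Z : FinGSet G} (g : Hom X Y) (f : Hom Y Z) : FinGSet G :=
  sub _ (evalSub g f)

/-- The projection of `evalObj g f` to the dependent product. -/
def evalProj {X Y Z : FinGSet G} (g : Hom X Y) (f : Hom Y Z) :
    Hom (evalObj g f) (depProd g f) where
  toFun p := p.1.2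
  map_smul' _ _ := rfl

/-- The evaluation map. -/
def evalMap {X Y Z : FinGSet G} (g : Hom X Y) (f : Hom Y Z) : Hom (evalObj g f) X where
  toFun p := p.1.1
  map_smul' _ _ := rfl

lemma isExponential_depProd {X Y Z : FinGSet G} (g : Hom X Y) (f : Hom Y Z) :
    IsExponential g f (depProdMap g f) (evalProj g f) (g.comp (evalMap g f)) (evalMap g f) where
  isPullback :=
    { comm := fun p => p.1.2.2.1 _ p.2
      existsUnique := fun y b h => by
        obtain ⟨x, hx, hu⟩ := b.2.2 y h
        refine ⟨⟨(x, b), hx.1⟩, ⟨hx.2, rfl⟩, fun p hp => ?_⟩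
        obtain ⟨⟨x', b'⟩, hp'⟩ := p
        obtain ⟨h1, rfl⟩ := hp
        exact Subtype.ext (Prod.ext (hu x' ⟨hp', h1⟩) rfl) }
  comm _ := rfl
  existsUnique z s hs := by
    refine ⟨⟨(z, Set.range s), ?_, fun y hy => ?_⟩, ⟨rfl, ?_⟩, ?_⟩
    · rintro _ ⟨y, rfl⟩
      rw [hs]
      exact y.2
    · refine ⟨s ⟨y, hy⟩, ⟨⟨_, rfl⟩, hs _⟩, ?_⟩
      rintro _ ⟨⟨y', rfl⟩, h⟩
      rw [hs] at h
      exact congrArg s (Subtype.ext h)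
    · rintro ⟨⟨x, b⟩, hx⟩ y hb hy
      change b = _ at hb
      subst hb
      obtain ⟨y', hy'⟩ := hx
      have h : g x = y.1 := hy
      have hx : s y' = x := hy'
      rw [← hx, hs] at h
      exact hx.symm.trans (congrArg s (Subtype.ext h))
    · rintro ⟨⟨z', A⟩, hA⟩ ⟨hz, h⟩
      change z' = z at hz
      subst hz
      refine Subtype.ext (Prod.ext rfl (Set.ext fun x => ⟨fun hx => ?_, ?_⟩))
      · exact ⟨⟨g x, hA.1 x hx⟩, (h ⟨(x, ⟨(z', A), hA⟩), hx⟩ ⟨g x, hA.1 x hx⟩ rfl rfl).symm⟩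
      · rintro ⟨y, rfl⟩
        obtain ⟨x, hx, -⟩ := hA.2 y.1 y.2
        rw [← h ⟨(x, ⟨(z', A), hA⟩), hx.1⟩ y rfl hx.2]
        exact hx.1

/-- A section over a nonempty fibre has a value. This keeps fibre bounds alive under norms. -/
lemma evalProj_surjective {X Y Z : FinGSet G} (g : Hom X Y) (f : Hom Y Z)
    (hf : Function.Surjective f) : Function.Surjective (evalProj g f) := by
  intro b
  obtain ⟨y, hy⟩ := hf b.1.1
  obtain ⟨x, hx, -⟩ := b.2.2 y hy
  exact ⟨⟨(x, b), hx.1⟩, rfl⟩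

/-- The exponential diagram behind the projection formula. -/
lemma isExponential_fold {X Y : FinGSet G} (f : Hom X Y) :
    IsExponential (sumMap f (MulActionHom.id G)) (fold Y) f (fold X) (sumMap f f)
      (sumMap (MulActionHom.id G) f) where
  isPullback :=
    { comm := fun p => by cases p <;> rfl
      existsUnique := fun y x h => by
        obtain ⟨p, hp, hu⟩ := (isPullback_fold f).existsUnique x y h.symm
        exact ⟨p, hp.symm, fun q hq => hu q hq.symm⟩ }
  comm p := by cases p <;> rfl
  existsUnique z s hs := by
    -- The fibre of the fold map over `z` has two points. A section picks a point of `f⁻¹(z)` over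
    -- the left one and has no choice over the right one, so sections over `z` correspond to points
    -- of `f⁻¹(z)`.
    obtain ⟨x, hx⟩ : ∃ x, s ⟨Sum.inl z, rfl⟩ = Sum.inl x := by
      rcases h : s ⟨Sum.inl z, rfl⟩ with x | x
      · exact ⟨x, rfl⟩
      · have := hs ⟨Sum.inl z, rfl⟩
        rw [h] at this
        exact (Sum.inr_ne_inl this).elim
    have hxz : f x = z := by
      have := hs ⟨Sum.inl z, rfl⟩
      rw [hx] at this
      exact Sum.inl_injective this
    have hz : s ⟨Sum.inr z, rfl⟩ = Sum.inr z := by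
      have := hs ⟨Sum.inr z, rfl⟩
      rcases h : s ⟨Sum.inr z, rfl⟩ with x | x
      · rw [h] at this
        exact (Sum.inl_ne_inr this).elim
      · rw [h] at this
        exact congrArg Sum.inr (Sum.inr_injective this)
    refine ⟨x, ⟨hxz, ?_⟩, fun x' hx' => ?_⟩
    · rintro (e | e) ⟨y, hy⟩ he h
      · obtain rfl : e = x := he
        obtain rfl : Sum.inl (f e) = y := h
        subst hxz
        exact hx.symm
      · obtain rfl : e = x := he
        obtain rfl : Sum.inr (f e) = y := h
        subst hxz
        exact hz.symm
    · have := hx'.2 (Sum.inl x') ⟨Sum.inl z, rfl⟩ rfl (congrArg Sum.inl hx'.1)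
      rw [hx] at this
      exact Sum.inl_injective this

end FinGSet

/-! ### Multiplicativity, the projection formula and decomposition along coproducts. -/

namespace TambaraFunctor

open FinGSet

variable {G : Type u} [Group G] (T : TambaraFunctor.{u, v} G)

/-- The element of `T(X ⨿ Y)` with given components. -/
lemma exists_res_inl_inr {X Y : FinGSet G} (a : T.obj X) (b : T.obj Y) :
    ∃ c : T.obj (sum X Y), T.res (inl X Y) c = a ∧ T.res (inr X Y) c = b := by
  obtain ⟨c, hc⟩ := (T.obj_sum X Y).2 (a, b)
  exact ⟨c, congrArg Prod.fst hc, congrArg Prod.snd hc⟩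

variable {T} in
lemma sum_ext {X Y : FinGSet G} {c d : T.obj (sum X Y)}
    (h1 : T.res (inl X Y) c = T.res (inl X Y) d) (h2 : T.res (inr X Y) c = T.res (inr X Y) d) :
    c = d :=
  (T.obj_sum X Y).1 (Prod.ext h1 h2)

lemma tr_copair {X Y Z : FinGSet G} (f : Hom X Z) (g : Hom Y Z) (c : T.obj (sum X Y)) :
    T.tr (copair f g) c = T.tr f (T.res (inl X Y) c) + T.tr g (T.res (inr X Y) c) := by
  rw [← fold_comp_sumMap, T.tr_comp, T.tr_fold, T.res_tr _ _ _ _ (isPullback_inl f g),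
    T.res_tr _ _ _ _ (isPullback_inr f g)]

lemma nm_copair {X Y Z : FinGSet G} (f : Hom X Z) (g : Hom Y Z) (c : T.obj (sum X Y)) :
    T.nm (copair f g) c = T.nm f (T.res (inl X Y) c) * T.nm g (T.res (inr X Y) c) := by
  rw [← fold_comp_sumMap, T.nm_comp, T.nm_fold, T.res_nm _ _ _ _ (isPullback_inl f g),
    T.res_nm _ _ _ _ (isPullback_inr f g)]

lemma res_copair_inl {X Y Z : FinGSet G} (f : Hom X Z) (g : Hom Y Z) (c : T.obj Z) :
    T.res (inl X Y) (T.res (copair f g) c) = T.res f c := by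
  rw [← T.res_comp, copair_comp_inl]

lemma res_copair_inr {X Y Z : FinGSet G} (f : Hom X Z) (g : Hom Y Z) (c : T.obj Z) :
    T.res (inr X Y) (T.res (copair f g) c) = T.res g c := by
  rw [← T.res_comp, copair_comp_inr]

lemma res_mul {X Y : FinGSet G} (f : Hom X Y) (a b : T.obj Y) :
    T.res f (a * b) = T.res f a * T.res f b := by
  obtain ⟨c, rfl, rfl⟩ := T.exists_res_inl_inr a b
  rw [← T.nm_fold, T.res_nm _ _ _ _ (isPullback_fold f), T.nm_fold, sumMap, ← T.res_comp,
    ← T.res_comp, copair_comp_inl, copair_comp_inr, T.res_comp, T.res_comp]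

lemma res_one {X Y : FinGSet G} (f : Hom X Y) : T.res f 1 = 1 := by
  obtain ⟨c⟩ := T.nonempty_obj_empty
  rw [← T.nm_fromEmpty Y c,
    T.res_nm (MulActionHom.id G) (fromEmpty X) f (fromEmpty Y)
      ⟨fun x => PEmpty.elim x, fun _ x => PEmpty.elim x⟩, T.nm_fromEmpty]

lemma nm_mul {X Y : FinGSet G} (f : Hom X Y) (a b : T.obj X) :
    T.nm f (a * b) = T.nm f a * T.nm f b := by
  obtain ⟨c, rfl, rfl⟩ := T.exists_res_inl_inr a b
  have h : f.comp (fold X) = copair f f := by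
    ext x
    cases x <;> rfl
  rw [← T.nm_fold, ← T.nm_comp, h, nm_copair]

lemma nm_one {X Y : FinGSet G} (f : Hom X Y) : T.nm f 1 = 1 := by
  obtain ⟨c⟩ := T.nonempty_obj_empty
  have hc : f.comp (fromEmpty X) = fromEmpty Y := by
    ext x
    exact PEmpty.elim x
  rw [← T.nm_fromEmpty X c, ← T.nm_comp, hc, T.nm_fromEmpty]

lemma res_pow {X Y : FinGSet G} (f : Hom X Y) (a : T.obj Y) (n : ℕ) :
    T.res f (a ^ n) = T.res f a ^ n := by
  induction n with
  | zero => simp only [pow_zero, res_one]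
  | succ n ih => rw [pow_succ, pow_succ, res_mul, ih]

lemma nm_pow {X Y : FinGSet G} (f : Hom X Y) (a : T.obj X) (n : ℕ) :
    T.nm f (a ^ n) = T.nm f a ^ n := by
  induction n with
  | zero => simp only [pow_zero, nm_one]
  | succ n ih => rw [pow_succ, pow_succ, nm_mul, ih]

/-- The projection formula. -/
lemma tr_mul_res {X Y : FinGSet G} (f : Hom X Y) (a : T.obj X) (b : T.obj Y) :
    T.tr f (a * T.res f b) = T.tr f a * b := by
  obtain ⟨c, rfl, rfl⟩ := T.exists_res_inl_inr a b
  have h := T.nm_tr _ _ _ _ _ _ (isExponential_fold f) c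
  rw [T.nm_fold, T.res_tr _ _ _ _ (isPullback_inl f (MulActionHom.id G)),
    T.res_tr _ _ _ _ (isPullback_inr f (MulActionHom.id G)), T.tr_id, T.nm_fold, sumMap,
    ← T.res_comp, ← T.res_comp, copair_comp_inl, copair_comp_inr, T.res_comp, T.res_comp,
    T.res_id] at h
  exact h.symm

/-- The projection formula applied twice, with base change of `T_g` along `f` in between. -/
lemma tr_mul_tr {X X' Y : FinGSet G} (f : Hom X Y) (g : Hom X' Y) (a : T.obj X) (b : T.obj X') :
    T.tr f a * T.tr g b = T.tr (f.comp (pullbackFst f g))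
      (T.res (pullbackFst f g) a * T.res (pullbackSnd f g) b) := by
  rw [T.tr_comp, mul_comm (T.res _ a), tr_mul_res,
    ← T.res_tr _ _ _ _ (isPullback_pullback f g), mul_comm (T.res f _), tr_mul_res]

section Bijective

variable {X Y : FinGSet G} (e : Hom X Y) (he : Function.Bijective e)
include he

lemma res_injective_of_bijective : Function.Injective (T.res e) := by
  obtain ⟨i, h1, h2⟩ := Function.bijective_iff_has_inverse.1 he
  have h : e.comp (e.inverse i h1 h2) = MulActionHom.id G := by
    ext y
    exact h2 y
  intro a b hab
  rw [← T.res_id a, ← T.res_id b, ← h, T.res_comp, T.res_comp, hab]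

lemma nm_res_of_bijective (a : T.obj Y) : T.nm e (T.res e a) = a := by
  apply res_injective_of_bijective T e he
  -- As `e` is injective, its pullback along itself is the identity square.
  rw [T.res_nm (MulActionHom.id G) (MulActionHom.id G) e e ⟨fun _ => rfl, fun x x' h =>
    ⟨x, ⟨rfl, he.1 h⟩, fun _ hp => hp.1⟩⟩, T.nm_id, T.res_id]

end Bijective

lemma eq_of_res_eq {A B X : FinGSet G} (i : Hom A X) (j : Hom B X)
    (h : Function.Bijective (copair i j)) {a b : T.obj X} (hi : T.res i a = T.res i b)
    (hj : T.res j a = T.res j b) : a = b := by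
  apply res_injective_of_bijective T _ h
  apply sum_ext
  · rwa [res_copair_inl, res_copair_inl]
  · rwa [res_copair_inr, res_copair_inr]

lemma nm_eq_mul {A B X Y : FinGSet G} (i : Hom A X) (j : Hom B X)
    (h : Function.Bijective (copair i j)) (f : Hom X Y) (a : T.obj X) :
    T.nm f a = T.nm (f.comp i) (T.res i a) * T.nm (f.comp j) (T.res j a) := by
  conv_lhs => rw [← nm_res_of_bijective T _ h a, nm_copair, res_copair_inl, res_copair_inr,
    nm_mul, ← T.nm_comp, ← T.nm_comp]

end TambaraFunctor

/-! ### Lower bounds on fibres. -/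

namespace FinGSet

variable {G : Type u} [Group G]

/-- All fibres of `f` have at least `m` elements. -/
def FibresGE {X Y : FinGSet G} (m : ℕ) (f : Hom X Y) : Prop :=
  ∀ y, Nonempty (Fin m ↪ {x // f x = y})

namespace FibresGE

lemma of_isPullback {P X X' Y : FinGSet G} {f' : Hom P X'} {g' : Hom P X} {f : Hom X Y}
    {g : Hom X' Y} {m : ℕ} (h : IsPullback f' g' f g) (hg : FibresGE m g) : FibresGE m g' := by
  intro x
  obtain ⟨φ⟩ := hg (f x)
  choose p hp _ using fun i => h.existsUnique x (φ i).1 (φ i).2.symm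
  refine ⟨⟨fun i => ⟨p i, (hp i).1⟩, fun i j hij => φ.injective (Subtype.ext ?_)⟩⟩
  exact (hp i).2.symm.trans ((congrArg (fun q => f' q.1) hij).trans (hp j).2)

/-- By surjectivity of `f`, each fibre of the composite contains a whole fibre of `g`. -/
lemma comp {X Y Z : FinGSet G} {f : Hom Y Z} {g : Hom X Y} {m : ℕ}
    (hf : Function.Surjective f) (hg : FibresGE m g) : FibresGE m (f.comp g) := by
  intro z
  obtain ⟨y, rfl⟩ := hf z
  obtain ⟨φ⟩ := hg y
  refine ⟨φ.trans ⟨fun x => ⟨x.1, congrArg f x.2⟩, fun a b h => Subtype.ext ?_⟩⟩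
  exact congrArg (fun x => x.1) h

lemma sumMap {X Y X' Y' : FinGSet G} {f : Hom X X'} {g : Hom Y Y'} {m : ℕ}
    (hf : FibresGE m f) (hg : FibresGE m g) : FibresGE m (sumMap f g) := by
  rintro (y | y)
  · obtain ⟨φ⟩ := hf y
    refine ⟨φ.trans ⟨fun x => ⟨Sum.inl x.1, congrArg Sum.inl x.2⟩, fun a b h => Subtype.ext ?_⟩⟩
    exact Sum.inl_injective (congrArg (fun x => x.1) h)
  · obtain ⟨φ⟩ := hg y
    refine ⟨φ.trans ⟨fun x => ⟨Sum.inr x.1, congrArg Sum.inr x.2⟩, fun a b h => Subtype.ext ?_⟩⟩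
    exact Sum.inr_injective (congrArg (fun x => x.1) h)

lemma copair {X Y Z : FinGSet G} {f : Hom X Z} {g : Hom Y Z} {m n : ℕ}
    (hf : FibresGE m f) (hg : FibresGE n g) : FibresGE (m + n) (copair f g) := by
  intro z
  obtain ⟨φ⟩ := hf z
  obtain ⟨ψ⟩ := hg z
  refine ⟨finSumFinEquiv.symm.toEmbedding.trans ((φ.sumMap ψ).trans
    ⟨Sum.elim (fun x => ⟨Sum.inl x.1, x.2⟩) (fun x => ⟨Sum.inr x.1, x.2⟩), ?_⟩)⟩
  rintro (a | a) (b | b) h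
  · exact congrArg Sum.inl (Subtype.ext (Sum.inl_injective (congrArg (fun x => x.1) h)))
  · exact (Sum.inl_ne_inr (congrArg (fun x => x.1) h)).elim
  · exact (Sum.inr_ne_inl (congrArg (fun x => x.1) h)).elim
  · exact congrArg Sum.inr (Subtype.ext (Sum.inr_injective (congrArg (fun x => x.1) h)))

lemma id (X : FinGSet G) : FibresGE 1 (MulActionHom.id G : Hom X X) := fun x =>
  ⟨⟨fun _ => ⟨x, rfl⟩, fun _ _ _ => Subsingleton.elim _ _⟩⟩

lemma zero {X Y : FinGSet G} (f : Hom X Y) : FibresGE 0 f := fun _ =>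
  ⟨⟨fun i => i.elim0, fun i => i.elim0⟩⟩

lemma empty {X : FinGSet G} {m : ℕ} (f : Hom X (empty G)) : FibresGE m f := fun y => PEmpty.elim y

end FibresGE

end FinGSet

/-! ### Transfers of multiples of norms of `y`. -/

namespace TambaraFunctor

open FinGSet

variable {G : Type u} [Group G] {T : TambaraFunctor.{u, v} G}

/-- `a` is the transfer of a multiple of some `N_v R_w y`, where all fibres of `v` have at least
`m` elements. -/
def IsTransferNorm {Z : FinGSet G} (y : T.obj Z) (m : ℕ) {X : FinGSet G} (a : T.obj X) : Prop :=
  ∃ (C D : FinGSet G) (f : Hom C X) (g : Hom D C) (w : Hom D Z) (c : T.obj C),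
    FibresGE m g ∧ a = T.tr f (c * T.nm g (T.res w y))

namespace IsTransferNorm

variable {Z X Y : FinGSet G} {y : T.obj Z} {m n : ℕ}

lemma zero : IsTransferNorm y m (0 : T.obj X) :=
  ⟨empty G, empty G, fromEmpty X, MulActionHom.id G, fromEmpty Z, 0, FibresGE.empty _,
    (T.tr_fromEmpty _ _).symm⟩

lemma add {a b : T.obj X} (ha : IsTransferNorm y m a) (hb : IsTransferNorm y m b) :
    IsTransferNorm y m (a + b) := by
  obtain ⟨C, D, f, g, w, c, hg, rfl⟩ := ha
  obtain ⟨C', D', f', g', w', c', hg', rfl⟩ := hb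
  obtain ⟨d, rfl, rfl⟩ := T.exists_res_inl_inr c c'
  refine ⟨_, _, copair f f', sumMap g g', copair w w', d, hg.sumMap hg', ?_⟩
  rw [tr_copair, res_mul, res_mul, T.res_nm _ _ _ _ (isPullback_inl g g'),
    T.res_nm _ _ _ _ (isPullback_inr g g'), res_copair_inl, res_copair_inr]

lemma mul_left (b : T.obj X) {a : T.obj X} (ha : IsTransferNorm y m a) :
    IsTransferNorm y m (b * a) := by
  obtain ⟨C, D, f, g, w, c, hg, rfl⟩ := ha
  refine ⟨C, D, f, g, w, T.res f b * c, hg, ?_⟩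
  rw [mul_comm b, ← tr_mul_res]
  ring_nf

lemma tr (f : Hom X Y) {a : T.obj X} (ha : IsTransferNorm y m a) :
    IsTransferNorm y m (T.tr f a) := by
  obtain ⟨C, D, f', g, w, c, hg, rfl⟩ := ha
  exact ⟨C, D, f.comp f', g, w, c, hg, (T.tr_comp _ _ _).symm⟩

lemma res (f : Hom X Y) {a : T.obj Y} (ha : IsTransferNorm y m a) :
    IsTransferNorm y m (T.res f a) := by
  obtain ⟨C, D, f', g, w, c, hg, rfl⟩ := ha
  refine ⟨_, _, pullbackFst f f', pullbackFst (pullbackSnd f f') g,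
    w.comp (pullbackSnd (pullbackSnd f f') g), T.res (pullbackSnd f f') c,
    hg.of_isPullback (isPullback_pullback _ _), ?_⟩
  rw [T.res_tr _ _ _ _ (isPullback_pullback f f'), res_mul,
    T.res_nm _ _ _ _ (isPullback_pullback (pullbackSnd f f') g), T.res_comp]

/-- The distributive law turns `N_f T_f'` into `T N R`; base change along the evaluation map moves
the restriction past `N_g`, and the two norms compose. Surjectivity of `f` prevents empty fibres of
the outer norm, over which the bound would be lost. -/
lemma nm (f : Hom X Y) (hf : Function.Surjective f) {a : T.obj X} (ha : IsTransferNorm y m a) :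
    IsTransferNorm y m (T.nm f a) := by
  obtain ⟨C, D, f', g, w, c, hg, rfl⟩ := ha
  refine ⟨_, _, depProdMap f' f, (evalProj f' f).comp (pullbackFst (evalMap f' f) g),
    w.comp (pullbackSnd (evalMap f' f) g), T.nm (evalProj f' f) (T.res (evalMap f' f) c),
    (hg.of_isPullback (isPullback_pullback _ _)).comp (evalProj_surjective f' f hf), ?_⟩
  rw [T.nm_tr _ _ _ _ _ _ (isExponential_depProd f' f), res_mul, nm_mul,
    T.res_nm _ _ _ _ (isPullback_pullback (evalMap f' f) g), T.res_comp, T.nm_comp]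

/-- Over the fibre product of `C` and `C'`, the two norms multiply to a single norm from a disjoint
union, whose fibres are the disjoint unions of the two fibres. -/
lemma mul {a b : T.obj X} (ha : IsTransferNorm y m a) (hb : IsTransferNorm y n b) :
    IsTransferNorm y (m + n) (a * b) := by
  obtain ⟨C, D, f, g, w, c, hg, rfl⟩ := ha
  obtain ⟨C', D', f', g', w', c', hg', rfl⟩ := hb
  refine ⟨_, _, f.comp (pullbackFst f f'),
    copair (pullbackFst (pullbackFst f f') g) (pullbackFst (pullbackSnd f f') g'),
    copair (w.comp (pullbackSnd (pullbackFst f f') g))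
      (w'.comp (pullbackSnd (pullbackSnd f f') g')),
    T.res (pullbackFst f f') c * T.res (pullbackSnd f f') c',
    (hg.of_isPullback (isPullback_pullback _ _)).copair
      (hg'.of_isPullback (isPullback_pullback _ _)), ?_⟩
  rw [tr_mul_tr, nm_copair, res_copair_inl, res_copair_inr, res_mul, res_mul,
    T.res_nm _ _ _ _ (isPullback_pullback (pullbackFst f f') g),
    T.res_nm _ _ _ _ (isPullback_pullback (pullbackSnd f f') g'), T.res_comp, T.res_comp]
  exact congrArg _ (mul_mul_mul_comm _ _ _ _)

lemma self (y : T.obj Z) : IsTransferNorm y 1 y := by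
  refine ⟨Z, Z, MulActionHom.id G, MulActionHom.id G, MulActionHom.id G, 1, FibresGE.id Z, ?_⟩
  rw [T.tr_id, T.nm_id, T.res_id, one_mul]

/-- The norm along `∅ → X` is `1`, so the bound `0` gives the unit ideal, matching `I ^ 0 = T`. -/
lemma of_zero (y : T.obj Z) (a : T.obj X) : IsTransferNorm y 0 a := by
  refine ⟨X, empty G, MulActionHom.id G, fromEmpty X, fromEmpty Z, a, FibresGE.zero _, ?_⟩
  rw [T.tr_id, T.nm_fromEmpty, mul_one]

end IsTransferNorm

end TambaraFunctor

/-! ### Powers of the ideal generated by `y`. -/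

namespace TambaraIdeal

open FinGSet TambaraFunctor

variable {G : Type u} [Group G] [Finite G] {T : TambaraFunctor.{u, v} G}

/-- The Tambara ideal of transfers of multiples of the `N_v R_w y`, where all fibres of `v` have
at least `m` elements. -/
def transferNorm {Z : FinGSet G} (y : T.obj Z) (m : ℕ) : TambaraIdeal T where
  level H :=
    { carrier := {a | IsTransferNorm y m a}
      zero_mem' := IsTransferNorm.zero
      add_mem' := IsTransferNorm.add
      smul_mem' := fun b _ ha => ha.mul_left b }
  res_mem _ _ ha := IsTransferNorm.res _ ha
  tr_mem _ _ ha := IsTransferNorm.tr _ ha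
  nm_mem h _ ha := IsTransferNorm.nm _ (fun x => by
    induction x using QuotientGroup.induction_on with
    | H x => exact ⟨(x : G ⧸ _), rfl⟩) ha
  conj_mem _ _ _ ha := IsTransferNorm.tr _ ha

lemma mem_transferNorm {Z : FinGSet G} {y : T.obj Z} {m : ℕ} {H : Subgroup G}
    {a : T.obj (orbit H)} : a ∈ (transferNorm y m).level H ↔ IsTransferNorm y m a := Iff.rfl

lemma pow_succ_eq_mul (I : TambaraIdeal T) (n : ℕ) : I ^ (n + 1) = I ^ n * I := rfl

lemma mem_sInf {S : Set (TambaraIdeal T)} {H : Subgroup G} {a : T.obj (orbit H)} :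
    a ∈ (sInf S).level H ↔ ∀ I ∈ S, a ∈ I.level H := by
  change a ∈ ⨅ I ∈ S, I.level H ↔ _
  simp only [Submodule.mem_iInf]

lemma mem_generatedBy {H : Subgroup G} (y : T.obj (orbit H)) : y ∈ (generatedBy y).level H :=
  mem_sInf.2 fun _ hI => hI

lemma generatedBy_le {H : Subgroup G} {y : T.obj (orbit H)} {I : TambaraIdeal T}
    (h : y ∈ I.level H) (K : Subgroup G) : (generatedBy y).level K ≤ I.level K :=
  fun _ ha => mem_sInf.1 ha I h

lemma level_mul_le (I J : TambaraIdeal T) (H : Subgroup G) :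
    I.level H * J.level H ≤ (I * J).level H :=
  fun _ ha => mem_sInf.2 fun _ hK => hK H ha

lemma mul_le {I J K : TambaraIdeal T} (h : ∀ H, I.level H * J.level H ≤ K.level H)
    (H : Subgroup G) : (I * J).level H ≤ K.level H :=
  fun _ ha => mem_sInf.1 ha K h

lemma pow_mem_pow {I : TambaraIdeal T} {H : Subgroup G} {a : T.obj (orbit H)}
    (ha : a ∈ I.level H) (n : ℕ) : a ^ n ∈ (I ^ n).level H := by
  induction n with
  | zero => exact Submodule.mem_top
  | succ n ih =>
    rw [pow_succ, pow_succ_eq_mul]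
    exact level_mul_le _ _ _ (Ideal.mul_mem_mul ih ha)

lemma eq_zero_of_level {I : TambaraIdeal T} (h : ∀ H, I.level H = ⊥) : I = 0 := by
  obtain ⟨level, _, _, _, _⟩ := I
  obtain rfl : level = fun _ => ⊥ := funext h
  rfl

lemma generatedBy_pow_le {H : Subgroup G} (y : T.obj (orbit H)) (n : ℕ) (K : Subgroup G) :
    (generatedBy y ^ n).level K ≤ (transferNorm y n).level K := by
  induction n generalizing K with
  | zero => exact fun a _ => IsTransferNorm.of_zero y a
  | succ n ih =>
    rw [pow_succ_eq_mul]
    refine mul_le (fun L => Ideal.mul_le.2 fun a ha b hb => ?_) K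
    exact (mem_transferNorm.1 (ih L ha)).mul
      (mem_transferNorm.1 (generatedBy_le (I := transferNorm y 1) (IsTransferNorm.self y) L hb))

end TambaraIdeal

/-! ### Splitting off orbits. -/

namespace FinGSet

variable {G : Type u} [Group G]

/-- The image of an equivariant map. -/
def rangeSub {X Y : FinGSet G} (f : Hom X Y) : SubMulAction G Y where
  carrier := Set.range f
  smul_mem' a _ := by
    rintro ⟨x, rfl⟩
    exact ⟨a • x, map_smul f a x⟩

lemma bijective_copair_incl {X Y : FinGSet G} (f : Hom X Y) (hf : Function.Injective f) :
    Function.Bijective (copair f (incl Y (complSub Y (rangeSub f)))) := by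
  refine ⟨?_, fun y => ?_⟩
  · rintro (a | a) (b | b) h
    · exact congrArg Sum.inl (hf h)
    · exact (b.2 ⟨a, h⟩).elim
    · exact (a.2 ⟨b, h.symm⟩).elim
    · exact congrArg Sum.inr (Subtype.ext h)
  · by_cases h : y ∈ rangeSub f
    · obtain ⟨x, hx⟩ := h
      exact ⟨Sum.inl x, hx⟩
    · exact ⟨Sum.inr ⟨y, h⟩, rfl⟩

/-- An equivariant map with values in an invariant subset. -/
def codRestrict {X Y : FinGSet G} (S : SubMulAction G Y) (f : Hom X Y) (h : ∀ x, f x ∈ S) :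
    Hom X (sub Y S) where
  toFun x := ⟨f x, h x⟩
  map_smul' a x := Subtype.ext (map_smul f a x)

/-- The map `G/S → X`, `gS ↦ gx`, for `x` fixed by `S`. -/
def pointMap [Finite G] {S : Subgroup G} {X : FinGSet G} (x : X)
    (h : S ≤ MulAction.stabilizer G x) : Hom (orbit S) X where
  toFun q := Quotient.liftOn' q (fun g : G => g • x) (fun a b hab => by
    have := h (QuotientGroup.leftRel_apply.1 hab)
    rw [MulAction.mem_stabilizer_iff, mul_smul, inv_smul_eq_iff] at this
    exact this.symm)
  map_smul' g q := by
    induction q using QuotientGroup.induction_on with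
    | H a => exact mul_smul g a x

lemma pointMap_mk [Finite G] {S : Subgroup G} {X : FinGSet G} (x : X)
    (h : S ≤ MulAction.stabilizer G x) (g : G) : pointMap x h (g : G ⧸ S) = g • x := rfl

lemma pointMap_injective [Finite G] {S : Subgroup G} {X : FinGSet G} (x : X)
    (h : MulAction.stabilizer G x = S) : Function.Injective (pointMap x h.ge) := by
  intro a b hab
  induction a using QuotientGroup.induction_on with
  | H a =>
  induction b using QuotientGroup.induction_on with
  | H b =>
  rw [pointMap_mk, pointMap_mk] at hab
  refine QuotientGroup.eq.2 ?_
  rw [← h, MulAction.mem_stabilizer_iff, mul_smul, ← hab, inv_smul_smul]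

lemma FibresGE.le_card {X Y : FinGSet G} {f : Hom X Y} {m : ℕ} (h : FibresGE m f) (y : Y) :
    m ≤ Nat.card X := by
  obtain ⟨φ⟩ := h y
  have := Nat.card_le_card_of_injective (fun i => (φ i).1)
    (Subtype.val_injective.comp φ.injective)
  rwa [Nat.card_fin] at this

end FinGSet

/-! ### Vanishing of norms with large fibres. -/

namespace TambaraFunctor

open FinGSet

variable {G : Type u} [Group G] {T : TambaraFunctor.{u, v} G}

/-- A norm from a disjoint union is a product, so each of the `k` disjoint copies of `E` in `D`
contributes the same factor, and the rest of `D` a cofactor. -/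
lemma nm_res_pow_dvd {C E Z : FinGSet G} (y : T.obj Z) (f₀ : Hom E C) (w₀ : Hom E Z) (k : ℕ)
    {D : FinGSet G} (f : Hom D C) (w : Hom D Z) (e : Fin k → Hom E D)
    (he : Function.Injective fun p : Fin k × E => e p.1 p.2) (hf : ∀ i, f.comp (e i) = f₀)
    (hw : ∀ i, w.comp (e i) = w₀) : T.nm f₀ (T.res w₀ y) ^ k ∣ T.nm f (T.res w y) := by
  induction k generalizing D with
  | zero => simp only [pow_zero, one_dvd]
  | succ k ih =>
    have h0 : Function.Injective (e 0) := fun a b h =>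
      congrArg Prod.snd (@he (0, a) (0, b) h)
    rw [nm_eq_mul T _ _ (bijective_copair_incl (e 0) h0) f, hf, ← T.res_comp, hw, ← T.res_comp,
      pow_succ']
    -- Joint injectivity places the remaining copies in the complement of the image of `e 0`.
    refine mul_dvd_mul_left _ (ih _ _ (fun i => codRestrict _ (e i.succ) ?_) ?_ ?_ ?_)
    · rintro x ⟨x', hx⟩
      exact (Fin.succ_ne_zero i).symm (congrArg Prod.fst (@he (0, x') (i.succ, x) hx))
    · rintro ⟨i, a⟩ ⟨j, b⟩ h
      have := @he (i.succ, a) (j.succ, b) (congrArg Subtype.val h)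
      exact Prod.ext (Fin.succ_injective _ (congrArg Prod.fst this)) (congrArg (·.2) this)
    · exact fun i => hf i.succ
    · exact fun i => hw i.succ

variable [Finite G]

lemma nm_res_eq_zero_of_transitive {C D Z : FinGSet G} [Nonempty Z] {y : T.obj Z} {k : ℕ}
    (hk : 0 < k) (hy : y ^ k = 0) (c : C) (hc : ∀ c', ∃ g : G, g • c = c') (f : Hom D C)
    (w : Hom D Z) (hf : FibresGE (Nat.card (Subgroup G × Z) * k * Nat.card G) f) :
    T.nm f (T.res w y) = 0 := by
  classical
  -- Representatives all lying over `c` make the maps `G/S → D → C` agree for different orbits.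
  have hrep : ∀ ω : MulAction.orbitRel.Quotient G D, ∃ d : D, Quotient.mk'' d = ω ∧ f d = c := by
    intro ω
    induction ω using Quotient.inductionOn' with
    | h d =>
    obtain ⟨g, hg⟩ := hc (f d)
    refine ⟨g⁻¹ • d, Quotient.sound' ⟨g⁻¹, rfl⟩, ?_⟩
    rw [map_smul, ← hg, inv_smul_smul]
  choose d hd hdc using hrep
  have hsurj : Function.Surjective
      fun p : MulAction.orbitRel.Quotient G D × G => p.2 • d p.1 := by
    intro x
    obtain ⟨g, hg⟩ := Quotient.exact' (hd (Quotient.mk'' x)).symm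
    exact ⟨(Quotient.mk'' x, g), hg⟩
  -- Cancelling `|G|` leaves at least `|Subgroup G × Z| * k` orbits, enough for `k` of them to share
  -- both the stabilizer of the representative and its image in `Z`.
  have hcard := (hf.le_card c).trans (Nat.card_le_card_of_surjective _ hsurj)
  rw [Nat.card_prod (MulAction.orbitRel.Quotient G D) G] at hcard
  replace hcard := Nat.le_of_mul_le_mul_right hcard Nat.card_pos
  let _ : Fintype (MulAction.orbitRel.Quotient G D) := Fintype.ofFinite _
  let _ : Fintype (Subgroup G × Z) := Fintype.ofFinite _
  rw [Nat.card_eq_fintype_card, Nat.card_eq_fintype_card] at hcard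
  obtain ⟨⟨S, z⟩, hS⟩ := Fintype.exists_le_card_fiber_of_mul_le_card
    (fun ω => (MulAction.stabilizer G (d ω), w (d ω))) hcard
  obtain ⟨φ, hφ⟩ := Finset.exists_subset_card_eq hS
  let ψ : Fin k → MulAction.orbitRel.Quotient G D := fun i => (φ.equivFinOfCardEq hφ.2).symm i
  have hψ : Function.Injective ψ :=
    Subtype.val_injective.comp (φ.equivFinOfCardEq hφ.2).symm.injective
  have hψS : ∀ i, MulAction.stabilizer G (d (ψ i)) = S ∧ w (d (ψ i)) = z := fun i =>
    Prod.ext_iff.1 (Finset.mem_filter.1 (hφ.1 ((φ.equivFinOfCardEq hφ.2).symm i).2)).2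
  let e : Fin k → Hom (orbit S) D := fun i => pointMap (d (ψ i)) (hψS i).1.ge
  have he : Function.Injective fun p : Fin k × orbit S => e p.1 p.2 := by
    rintro ⟨i, a⟩ ⟨j, b⟩ h
    have hij : i = j := by
      apply hψ
      induction a using QuotientGroup.induction_on with
      | H a =>
      induction b using QuotientGroup.induction_on with
      | H b =>
      have h : a • d (ψ i) = b • d (ψ j) := h
      rw [← hd (ψ i), ← hd (ψ j)]
      refine Quotient.sound' ⟨a⁻¹ * b, ?_⟩
      change (a⁻¹ * b) • d (ψ j) = d (ψ i)
      rw [mul_smul, ← h, inv_smul_smul]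
    subst hij
    exact Prod.ext rfl (pointMap_injective _ (hψS i).1 h)
  have hfe : ∀ i j, f.comp (e i) = f.comp (e j) := by
    intro i j
    ext a
    induction a using QuotientGroup.induction_on with
    | H a =>
    change f (a • d (ψ i)) = f (a • d (ψ j))
    rw [map_smul, map_smul, hdc, hdc]
  have hwe : ∀ i j, w.comp (e i) = w.comp (e j) := by
    intro i j
    ext a
    induction a using QuotientGroup.induction_on with
    | H a =>
    change w (a • d (ψ i)) = w (a • d (ψ j))
    rw [map_smul, map_smul, (hψS i).2, (hψS j).2]
  have hdvd := nm_res_pow_dvd y _ _ k f w e he (fun i => hfe i ⟨0, hk⟩) (fun i => hwe i ⟨0, hk⟩)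
  -- The divisor is the norm of the restriction of `y ^ k = 0`; `N 0 = 0` needs surjectivity onto
  -- `C`, which transitivity supplies.
  rw [← nm_pow, ← res_pow, hy, res_zero, nm_zero, zero_dvd_iff] at hdvd
  · exact hdvd
  · intro c'
    obtain ⟨g, rfl⟩ := hc c'
    refine ⟨(g : G ⧸ S), ?_⟩
    change f (g • d (ψ ⟨0, hk⟩)) = g • c
    rw [map_smul, hdc]

/-- Vanishing is tested on an orbit of `C` and on its complement, by induction on `|C|`; base change
preserves the fibre bound on both pieces. -/
lemma nm_res_eq_zero {Z : FinGSet G} [Nonempty Z] {y : T.obj Z} {k : ℕ} (hk : 0 < k)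
    (hy : y ^ k = 0) {C D : FinGSet G} (f : Hom D C) (w : Hom D Z)
    (hf : FibresGE (Nat.card (Subgroup G × Z) * k * Nat.card G) f) :
    T.nm f (T.res w y) = 0 := by
  induction hn : Nat.card C using Nat.strong_induction_on generalizing C D with
  | h n ih =>
  rcases isEmpty_or_nonempty C with hC | ⟨⟨c⟩⟩
  · have hb : Function.Bijective (fromEmpty C) :=
      ⟨fun x => PEmpty.elim x, fun x => (hC.false x).elim⟩
    obtain ⟨h⟩ := T.obj_empty
    exact res_injective_of_bijective T _ hb (h.uniq _ |>.trans (h.uniq _).symm)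
  · have hi := pointMap_injective c rfl
    refine T.eq_of_res_eq _ _ (bijective_copair_incl _ hi) ?_ ?_
    · rw [T.res_nm _ _ _ _ (isPullback_pullback _ f), ← T.res_comp, res_zero]
      refine nm_res_eq_zero_of_transitive hk hy ((1 : G) : G ⧸ MulAction.stabilizer G c)
        (fun c' => ?_) _ _ (hf.of_isPullback (isPullback_pullback _ f))
      induction c' using QuotientGroup.induction_on with
      | H g => exact ⟨g, congrArg _ (mul_one g)⟩
    · rw [T.res_nm _ _ _ _ (isPullback_pullback _ f), ← T.res_comp, res_zero]
      refine ih _ ?_ _ _ (hf.of_isPullback (isPullback_pullback _ f)) rfl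
      rw [← hn]
      refine Finite.card_subtype_lt (x := c) ?_
      exact fun h => h ⟨((1 : G) : G ⧸ MulAction.stabilizer G c), one_smul G c⟩

end TambaraFunctor

theorem mainTheorem4 {G : Type u} [Group G] [Finite G] (T : TambaraFunctor.{u, v} G)
    (H : Subgroup G) (y : T.obj (FinGSet.orbit H)) :
    IsNilpotent y ↔ ∃ n : ℕ, TambaraIdeal.generatedBy y ^ n = 0 := by
  constructor
  · rintro ⟨k, hk⟩
    have : Nonempty (FinGSet.orbit H) := ⟨((1 : G) : G ⧸ H)⟩
    -- The vanishing lemma needs a positive exponent, while `k` may be `0`; hence `k + 1`.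
    refine ⟨_, TambaraIdeal.eq_zero_of_level fun K => eq_bot_iff.2
      ((TambaraIdeal.generatedBy_pow_le y
        (Nat.card (Subgroup G × FinGSet.orbit H) * (k + 1) * Nat.card G) K).trans ?_)⟩
    rintro _ ⟨C, D, f, g, w, c, hg, rfl⟩
    rw [TambaraFunctor.nm_res_eq_zero k.succ_pos (by rw [pow_succ, hk, zero_mul]) g w hg,
      mul_zero, T.tr_zero]
    exact Submodule.zero_mem _
  · rintro ⟨n, hn⟩
    have h := TambaraIdeal.pow_mem_pow (TambaraIdeal.mem_generatedBy y) n
    rw [hn] at h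
    exact ⟨n, (Submodule.mem_bot _).1 h⟩
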